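/- Fix an integer $m\ge 1$. Let $G_n^m$ be the preferential attachment random multigraph, defined inductively: $G_1^m$ is a single vertex with $m$ self-loops, and $G_n^m$ is obtained from $G_{n-1}^m$ by adding a new node $u$ (which joins at time $n$) and then inserting $m$ edges $(u,v_1),\dots,(u,v_m)$ one after the other; if $M_i$ is the sum of the degrees of all nodes just before the $i$-th of these edges is inserted, then, given the current multigraph, $v_i$ equals a node $v\ne u$ with probability $\frac{\deg(v)}{M_i+1}$ and equals $u$ with probability $\frac{\deg(u)+1}{M_i+1}$, where degrees are the current ones and a self-loop contributes $2$ to the degree of its node. Then, with probability tending to $1$ as $n\to\infty$, every node of $G_n^m$ that joined before time $n^{0.3}$ has degree at least $\log^3 n = (\ln n)^3$ in $G_n^m$. -/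

import Mathlib

open Filter Topology

noncomputable section

/-- A finite multigraph (parallel edges and loops allowed) on the vertex set `V`, given by its
multiset of unoriented edges. The element `s(v, v)` of `Sym2 V` is a loop at `v`. -/
abbrev Multigraph (V : Type) : Type := Multiset (Sym2 V)

namespace Multigraph

variable {V : Type} [DecidableEq V]

/-- The degree of `v`: the number of edges incident with `v`, where a loop at `v` is counted
twice. -/
def degree (G : Multigraph V) (v : V) : ℕ :=
  G.countP (fun e => v ∈ e) + G.count s(v, v)

variable [Fintype V]

/-- The sum of the degrees of all the nodes. -/
def degreeSum (G : Multigraph V) : ℕ := ∑ v, G.degree v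

/-- The law of the random endpoint of an edge that is inserted at the new node `u` when the
current multigraph is `G`: with `M` the current degree sum, a node `v ≠ u` is chosen with
probability `deg v / (M + 1)`, and `u` itself with probability `(deg u + 1) / (M + 1)`. -/
def endpointLaw (G : Multigraph V) (u : V) : PMF V :=
  PMF.ofFintype
    (fun v => ((if v = u then G.degree v + 1 else G.degree v : ℕ) : ENNReal) /
      ((G.degreeSum + 1 : ℕ) : ENNReal))
    (by
      have h : ∑ v, (if v = u then G.degree v + 1 else G.degree v) = G.degreeSum + 1 := by
        have h' : ∀ v, (if v = u then G.degree v + 1 else G.degree v)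
            = G.degree v + (if v = u then 1 else 0) := by
          intro v; split_ifs <;> rfl
        simp [h', Finset.sum_add_distrib, degreeSum]
      simp only [div_eq_mul_inv]
      rw [← Finset.sum_mul, ← Nat.cast_sum, h]
      exact ENNReal.mul_inv_cancel (Nat.cast_ne_zero.mpr (Nat.succ_ne_zero G.degreeSum))
        (ENNReal.natCast_ne_top _))

/-- Insert one random edge at `u`. -/
def attachEdge (u : V) (G : Multigraph V) : PMF (Multigraph V) :=
  (G.endpointLaw u).map (fun v => s(u, v) ::ₘ G)

/-- Insert `k` random edges at `u`, one after the other, the degrees being updated after each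
insertion. -/
def attachEdges (u : V) : ℕ → Multigraph V → PMF (Multigraph V)
  | 0, G => PMF.pure G
  | k + 1, G => (attachEdges u k G).bind (attachEdge u)

end Multigraph

/-- The law of the preferential attachment graph `G_n^m`. The vertex set is `Fin n`, and the node
that joins at time `t` (for `1 ≤ t ≤ n`) has the label `t - 1`. `G_1^m` is a single vertex with
`m` loops, and `G_{n+1}^m` arises from `G_n^m` by adding a new node and then `m` random edges at
this node. (The value at `n = 0` is the empty graph, by convention.) -/
def paGraph (m : ℕ) : (n : ℕ) → PMF (Multigraph (Fin n))
  | 0 => PMF.pure 0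
  | 1 => PMF.pure (Multiset.replicate m s(0, 0))
  | n + 2 => (paGraph m (n + 1)).bind fun G =>
      Multigraph.attachEdges (Fin.last (n + 1)) m (G.map (Sym2.map Fin.castSucc))

/-- The time at which a node of `G_n^m` joins the network. -/
def joinTime {n : ℕ} (v : Fin n) : ℕ := (v : ℕ) + 1

end

/-!
Fix `0 ≤ θ < 1` and a node `w`. If `f` satisfies `f (d + 1) = (1 - θ / d) * f d`, then inserting one
edge at another node, when `e` edges are present, multiplies the expectation of `f (deg w)` by
exactly `1 - θ / (2 * e + 1)`: the degree of `w` grows with probability `d / (2 * e + 1)`, and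
growth costs `f` the proportion `θ / d`, so that `d` cancels. For a node that joins at time `t` the
product of these factors up to time `n` is of order `(t / n) ^ (θ / 2)`. On the other hand `f d` is
at least `(1 - θ) / d`, so by Markov's inequality the degree at time `n` is below `L` with
probability `O(L * (t / n) ^ (θ / 2))`. The union bound over the nodes with `t < n ^ α` gives
`O(L * n ^ (α - (1 - α) * θ / 2))`, which for `L = O(n ^ b)` with `3 * α + 2 * b < 1` tends to `0`
once `θ` is close enough to `1`.
-/

section Mean

open scoped ENNReal

variable {α β : Type*}

/-- The expectation `E[F]` of a function `F` with values in `[0, ∞]` under a `PMF`, as a series, so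
that no measurable structure on the sample space has to be chosen. -/
noncomputable def pmfMean (p : PMF α) (F : α → ℝ≥0∞) : ℝ≥0∞ := ∑' a, p a * F a

theorem pmfMean_pure (a : α) (F : α → ℝ≥0∞) : pmfMean (PMF.pure a) F = F a := by
  rw [pmfMean, tsum_eq_single a fun b hb => by simp [hb]]
  simp

theorem pmfMean_bind (p : PMF α) (q : α → PMF β) (F : β → ℝ≥0∞) :
    pmfMean (p.bind q) F = pmfMean p fun a => pmfMean (q a) F := by
  simp only [pmfMean, PMF.bind_apply, ← ENNReal.tsum_mul_right, ← ENNReal.tsum_mul_left, mul_assoc]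
  exact ENNReal.tsum_comm

theorem pmfMean_map (p : PMF α) (g : α → β) (F : β → ℝ≥0∞) :
    pmfMean (p.map g) F = pmfMean p (F ∘ g) := by
  rw [← PMF.bind_pure_comp, pmfMean_bind]
  simp only [Function.comp_def, pmfMean_pure]

theorem pmfMean_const (p : PMF α) (c : ℝ≥0∞) : (pmfMean p fun _ => c) = c := by
  rw [pmfMean, ENNReal.tsum_mul_right, p.tsum_coe, one_mul]

theorem pmfMean_const_mul (p : PMF α) (c : ℝ≥0∞) (F : α → ℝ≥0∞) :
    (pmfMean p fun a => c * F a) = c * pmfMean p F := by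
  simp only [pmfMean, mul_left_comm, ENNReal.tsum_mul_left]

theorem pmfMean_congr {p : PMF α} {F F' : α → ℝ≥0∞} (h : ∀ a ∈ p.support, F a = F' a) :
    pmfMean p F = pmfMean p F' := by
  refine tsum_congr fun a => ?_
  by_cases ha : a ∈ p.support
  · rw [h a ha]
  · rw [(p.apply_eq_zero_iff a).2 ha, zero_mul, zero_mul]

theorem pmfMean_mono (p : PMF α) {F F' : α → ℝ≥0∞} (h : F ≤ F') : pmfMean p F ≤ pmfMean p F' :=
  ENNReal.tsum_le_tsum fun a => mul_le_mul_right (h a) (p a)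

theorem sum_toReal_apply [Fintype α] (p : PMF α) : ∑ a, (p a).toReal = 1 := by
  rw [← ENNReal.toReal_sum fun a _ => p.apply_ne_top a, ← tsum_fintype (L := .unconditional α),
    p.tsum_coe, ENNReal.toReal_one]

theorem pmfMean_ofReal [Fintype α] (p : PMF α) {f : α → ℝ} (hf : 0 ≤ f) :
    (pmfMean p fun a => ENNReal.ofReal (f a)) = ENNReal.ofReal (∑ a, (p a).toReal * f a) := by
  rw [pmfMean, tsum_fintype,
    ENNReal.ofReal_sum_of_nonneg fun a _ => mul_nonneg ENNReal.toReal_nonneg (hf a)]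
  refine Finset.sum_congr rfl fun a _ => ?_
  rw [ENNReal.ofReal_mul ENNReal.toReal_nonneg, ENNReal.ofReal_toReal (p.apply_ne_top a)]

theorem toOuterMeasure_le_pmfMean {p : PMF α} {S : Set α} {F : α → ℝ≥0∞}
    (h : ∀ a ∈ p.support, a ∈ S → 1 ≤ F a) : p.toOuterMeasure S ≤ pmfMean p F := by
  rw [p.toOuterMeasure_apply]
  refine ENNReal.tsum_le_tsum fun a => Set.indicator_apply_le' (fun haS => ?_) fun _ => zero_le
  by_cases ha : a ∈ p.support
  · exact le_mul_of_one_le_right' (h a ha haS)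
  · simp [(p.apply_eq_zero_iff a).2 ha]

theorem toOuterMeasure_eq_one_sub_compl (p : PMF α) (S : Set α) :
    p.toOuterMeasure S = 1 - p.toOuterMeasure Sᶜ := by
  let _ : MeasurableSpace α := ⊤
  simp only [← p.toMeasure_apply_eq_toOuterMeasure]
  rw [← MeasureTheory.prob_compl_eq_one_sub MeasurableSpace.measurableSet_top, compl_compl]

theorem tendsto_toOuterMeasure_one_of_compl {ι : Type*} {l : Filter ι} {γ : ι → Type*}
    {p : ∀ i, PMF (γ i)} {S : ∀ i, Set (γ i)}
    (h : Tendsto (fun i => (p i).toOuterMeasure (S i)ᶜ) l (𝓝 0)) :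
    Tendsto (fun i => (p i).toOuterMeasure (S i)) l (𝓝 1) := by
  simpa only [← toOuterMeasure_eq_one_sub_compl, tsub_zero] using
    ENNReal.Tendsto.sub (tendsto_const_nhds (x := (1 : ℝ≥0∞))) h (Or.inl ENNReal.one_ne_top)

end Mean

section RealBounds

open scoped Asymptotics

theorem one_sub_div_natCast_nonneg {θ : ℝ} (hθ : θ ≤ 1) {j : ℕ} (hj : 1 ≤ j) : 0 ≤ 1 - θ / j := by
  have hj' : (1 : ℝ) ≤ j := by exact_mod_cast hj
  rw [sub_nonneg, div_le_one (by linarith)]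
  exact hθ.trans hj'

theorem one_sub_div_two_mul_add_one_nonneg {θ : ℝ} (hθ : θ ≤ 1) (j : ℕ) :
    0 ≤ 1 - θ / (2 * (j : ℝ) + 1) := by
  exact_mod_cast one_sub_div_natCast_nonneg hθ (Nat.le_add_left 1 (2 * j))

theorem one_sub_div_le_div_add_one_rpow {c x : ℝ} (hc : 0 ≤ c) (hx : 0 < x) :
    1 - c / x ≤ (x / (x + 1)) ^ c := by
  have hbase : Real.exp (-x⁻¹) ≤ x / (x + 1) := by
    have := Real.add_one_le_exp x⁻¹
    rw [Real.exp_neg, inv_le_comm₀ (Real.exp_pos _) (by positivity), inv_div]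
    calc (x + 1) / x = x⁻¹ + 1 := by field_simp; ring
      _ ≤ Real.exp x⁻¹ := this
  calc 1 - c / x ≤ Real.exp (-(c / x)) := Real.one_sub_le_exp_neg _
    _ = Real.exp (-x⁻¹) ^ c := by
        rw [← Real.exp_mul]
        congr 1
        ring
    _ ≤ (x / (x + 1)) ^ c := Real.rpow_le_rpow (Real.exp_nonneg _) hbase hc

theorem prod_Ico_one_sub_div_le {c t : ℝ} (hc : 0 ≤ c) {a b : ℕ} (ht : 0 < a + t)
    (hca : c ≤ a + t) (hab : a ≤ b) :
    ∏ j ∈ Finset.Ico a b, (1 - c / (j + t)) ≤ ((a + t) / (b + t)) ^ c := by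
  induction b, hab using Nat.le_induction with
  | base => simp [ht.ne']
  | succ b hab ih =>
    have hab' : (a : ℝ) ≤ b := by exact_mod_cast hab
    have hbt : 0 < b + t := by linarith
    have hfactor : 0 ≤ 1 - c / (b + t) := by
      rw [sub_nonneg, div_le_one hbt]
      linarith
    calc ∏ j ∈ Finset.Ico a (b + 1), (1 - c / (j + t))
        = (∏ j ∈ Finset.Ico a b, (1 - c / (j + t))) * (1 - c / (b + t)) :=
          Finset.prod_Ico_succ_top hab _
      _ ≤ ((a + t) / (b + t)) ^ c * ((b + t) / (b + t + 1)) ^ c := by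
          gcongr
          exact one_sub_div_le_div_add_one_rpow hc hbt
      _ = ((a + t) / ((b + 1 : ℕ) + t)) ^ c := by
          rw [← Real.mul_rpow (by positivity) (by positivity),
            div_mul_div_cancel₀ hbt.ne', Nat.cast_succ, add_right_comm]

theorem prod_Ico_one_sub_div_two_mul_add_one_le {θ : ℝ} (hθ₀ : 0 ≤ θ) (hθ₁ : θ ≤ 1) {m t n : ℕ}
    (hm : 1 ≤ m) (ht : 1 ≤ t) (htn : t ≤ n) :
    ∏ j ∈ Finset.Ico (m * t) (m * n), (1 - θ / (2 * (j : ℝ) + 1))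
      ≤ (2 * t / n : ℝ) ^ (θ / 2) := by
  have hm' : (1 : ℝ) ≤ m := by exact_mod_cast hm
  have ht' : (1 : ℝ) ≤ t := by exact_mod_cast ht
  have hn' : (1 : ℝ) ≤ n := by exact_mod_cast ht.trans htn
  have hratio : ((m * t : ℕ) + 1 / 2 : ℝ) / ((m * n : ℕ) + 1 / 2) ≤ 2 * t / n := by
    have hmt' : (1 : ℝ) ≤ m * t := one_le_mul_of_one_le_of_one_le hm' ht'
    rw [div_le_div_iff₀ (by positivity) (by positivity)]
    push_cast
    nlinarith [mul_le_mul_of_nonneg_right hmt' (by linarith : (0 : ℝ) ≤ n)]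
  calc ∏ j ∈ Finset.Ico (m * t) (m * n), (1 - θ / (2 * (j : ℝ) + 1))
      = ∏ j ∈ Finset.Ico (m * t) (m * n), (1 - (θ / 2) / (j + 1 / 2)) := by
        refine Finset.prod_congr rfl fun j _ => ?_
        field_simp
    _ ≤ (((m * t : ℕ) + 1 / 2) / ((m * n : ℕ) + 1 / 2)) ^ (θ / 2) :=
        prod_Ico_one_sub_div_le (by linarith) (by linarith) (by linarith)
          (Nat.mul_le_mul_left m htn)
    _ ≤ (2 * t / n : ℝ) ^ (θ / 2) := by gcongr

theorem exists_union_bound_exponent_neg {α b : ℝ} (h : 3 * α + 2 * b < 1) :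
    ∃ θ : ℝ, 0 ≤ θ ∧ θ < 1 ∧ α + b + (α - 1) * (θ / 2) < 0 := by
  have hlim : Tendsto (fun θ : ℝ => α + b + (α - 1) * (θ / 2)) (𝓝[<] 1)
      (𝓝 (α + b + (α - 1) * (1 / 2))) :=
    (Continuous.tendsto (by fun_prop) 1).mono_left nhdsWithin_le_nhds
  have hneg : ∀ᶠ θ in 𝓝[<] (1 : ℝ), α + b + (α - 1) * (θ / 2) < 0 :=
    hlim.eventually (gt_mem_nhds (by linarith))
  obtain ⟨θ, hθ, hθ₀, hθ₁⟩ := (hneg.and (Ioo_mem_nhdsLT one_pos)).exists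
  exact ⟨θ, hθ₀.le, hθ₁, hθ⟩

theorem tendsto_union_bound {α b θ : ℝ} (h : α + b + (α - 1) * (θ / 2) < 0) (C : ℝ) :
    Tendsto (fun n : ℕ => (n : ℝ) ^ α *
        (C * (n : ℝ) ^ b / (1 - θ) * (2 * (n : ℝ) ^ α / n) ^ (θ / 2))) atTop (𝓝 0) := by
  have hpow : Tendsto (fun n : ℕ => (n : ℝ) ^ (α + b + (α - 1) * (θ / 2))) atTop (𝓝 0) := by
    simpa only [neg_neg, Function.comp_def] using
      (tendsto_rpow_neg_atTop (neg_pos.2 h)).comp tendsto_natCast_atTop_atTop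
  have hlim := hpow.const_mul (C / (1 - θ) * 2 ^ (θ / 2))
  rw [mul_zero] at hlim
  refine hlim.congr' ?_
  filter_upwards [eventually_gt_atTop 0] with n hn
  have hn' : (0 : ℝ) < n := by exact_mod_cast hn
  rw [mul_div_assoc 2, ← Real.rpow_sub_one hn'.ne', Real.mul_rpow zero_le_two (by positivity),
    ← Real.rpow_mul hn'.le, Real.rpow_add hn', Real.rpow_add hn']
  ring

theorem isBigO_log_natCast_pow_rpow (k : ℕ) {b : ℝ} (hb : 0 < b) :
    (fun n : ℕ => Real.log n ^ k) =O[atTop] fun n : ℕ => (n : ℝ) ^ b := by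
  simpa only [Function.comp_def, Real.rpow_natCast] using
    ((isLittleO_log_rpow_rpow_atTop (k : ℝ) hb).comp_tendsto
      tendsto_natCast_atTop_atTop).isBigO

end RealBounds

namespace Multigraph

section Degree

variable {V : Type} [DecidableEq V]

theorem degree_add (G H : Multigraph V) (v : V) :
    degree (G + H : Multigraph V) v = G.degree v + H.degree v := by
  simp only [degree, Multiset.countP_add, Multiset.count_add]
  ring

theorem degree_cons (G : Multigraph V) (a b v : V) :
    degree (s(a, b) ::ₘ G) v
      = G.degree v + ((if v = a then 1 else 0) + if v = b then 1 else 0) := by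
  simp only [degree, Multiset.countP_cons, Multiset.count_cons, Sym2.mem_iff, Sym2.eq_iff]
  grind

theorem card_le_degree {G : Multigraph V} {u : V} (h : ∀ e ∈ G, u ∈ e) :
    G.card ≤ G.degree u :=
  (Multiset.countP_eq_card.2 h).ge.trans (Nat.le_add_right _ _)

theorem degree_map {W : Type} [DecidableEq W] (G : Multigraph V) {g : V → W}
    (hg : Function.Injective g) (v : V) :
    degree (G.map (Sym2.map g) : Multigraph W) (g v) = G.degree v := by
  induction G using Multiset.induction_on with
  | empty => simp [degree]
  | cons e G ih =>
    induction e using Sym2.ind with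
    | _ a b => simp only [Multiset.map_cons, Sym2.map_mk, degree_cons, ih, hg.eq_iff]

theorem degreeSum_eq_two_mul_card [Fintype V] (G : Multigraph V) : G.degreeSum = 2 * G.card := by
  induction G using Multiset.induction_on with
  | empty => simp [degreeSum, degree]
  | cons e G ih =>
    induction e using Sym2.ind with
    | _ a b =>
      have hloops : ∑ v, ((if v = a then 1 else 0) + if v = b then 1 else 0) = 2 := by
        simp [Finset.sum_add_distrib]
      simp only [degreeSum, degree_cons] at ih ⊢
      rw [Finset.sum_add_distrib, ih, hloops, Multiset.card_cons, mul_add_one]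

end Degree

section AttachEdges

variable {V : Type} [DecidableEq V] [Fintype V]

theorem toReal_endpointLaw_apply (G : Multigraph V) {u v : V} (h : v ≠ u) :
    (G.endpointLaw u v).toReal = G.degree v / (2 * G.card + 1) := by
  rw [endpointLaw, PMF.ofFintype_apply, if_neg h, ENNReal.toReal_div, ENNReal.toReal_natCast,
    ENNReal.toReal_natCast, degreeSum_eq_two_mul_card]
  push_cast
  rfl

theorem exists_eq_map_add_of_mem_support_attachEdges {u : V} {k : ℕ} {G H : Multigraph V}
    (h : H ∈ (attachEdges u k G).support) :
    ∃ t : Multiset V, t.card = k ∧ H = t.map (fun v => s(u, v)) + G := by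
  induction k generalizing H with
  | zero => exact ⟨0, rfl, by simpa [attachEdges] using h⟩
  | succ k ih =>
    rw [attachEdges, PMF.mem_support_bind_iff] at h
    obtain ⟨H', hH', h⟩ := h
    obtain ⟨t, rfl, rfl⟩ := ih hH'
    obtain ⟨v, -, rfl⟩ := (PMF.mem_support_map_iff _ _ _).1 h
    exact ⟨v ::ₘ t, Multiset.card_cons v t, by rw [Multiset.map_cons, Multiset.cons_add]⟩

theorem card_of_mem_support_attachEdges {u : V} {k : ℕ} {G H : Multigraph V}
    (h : H ∈ (attachEdges u k G).support) : H.card = G.card + k := by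
  obtain ⟨t, rfl, rfl⟩ := exists_eq_map_add_of_mem_support_attachEdges h
  rw [Multiset.card_add, Multiset.card_map, add_comm]

theorem degree_le_of_mem_support_attachEdges {u : V} {k : ℕ} {G H : Multigraph V}
    (h : H ∈ (attachEdges u k G).support) (v : V) : G.degree v ≤ H.degree v := by
  obtain ⟨t, -, rfl⟩ := exists_eq_map_add_of_mem_support_attachEdges h
  rw [degree_add]
  exact Nat.le_add_left _ _

theorem le_degree_self_of_mem_support_attachEdges {u : V} {k : ℕ} {G H : Multigraph V}
    (h : H ∈ (attachEdges u k G).support) : k ≤ H.degree u := by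
  obtain ⟨t, rfl, rfl⟩ := exists_eq_map_add_of_mem_support_attachEdges h
  have hstar : ∀ e ∈ t.map (fun v => s(u, v)), u ∈ e := by simp
  rw [degree_add, ← Multiset.card_map (fun v => s(u, v)) t]
  exact (card_le_degree hstar).trans (Nat.le_add_right _ _)

theorem attachEdges_of_subsingleton [Subsingleton V] (u : V) (k : ℕ) (G : Multigraph V) :
    attachEdges u k G = PMF.pure (Multiset.replicate k s(u, u) + G : Multigraph V) := by
  have hsupp : (attachEdges u k G).support = {Multiset.replicate k s(u, u) + G} := by
    refine (PMF.support_nonempty _).subset_singleton_iff.1 fun H hH => ?_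
    obtain ⟨t, rfl, rfl⟩ := exists_eq_map_add_of_mem_support_attachEdges hH
    simp [Subsingleton.elim _ u, Multiset.map_const']
  ext H
  by_cases hH : H = Multiset.replicate k s(u, u) + G
  · simpa [hH] using (PMF.apply_eq_one_iff _ _).2 hsupp
  · rw [(PMF.apply_eq_zero_iff _ _).2 (by simp [hsupp, hH]), PMF.pure_apply_of_ne _ _ hH]

end AttachEdges

section DegreePotential

variable {θ : ℝ}

/-- The function of a degree `d` determined by `f 1 = 1` and `f (d + 1) = (1 - θ / d) * f d`, that
is, `Γ(d - θ) / (Γ(1 - θ) * Γ(d))`, of order `d ^ (-θ)`. Its expectation along the process of edge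
insertions is multiplied in each step by a factor that does not depend on the degrees. -/
noncomputable def degreePotential (θ : ℝ) (d : ℕ) : ℝ := ∏ j ∈ Finset.Ico 1 d, (1 - θ / j)

theorem degreePotential_succ {d : ℕ} (hd : 1 ≤ d) :
    degreePotential θ (d + 1) = (1 - θ / d) * degreePotential θ d := by
  rw [degreePotential, Finset.prod_Ico_succ_top hd, mul_comm, degreePotential]

theorem degreePotential_nonneg (hθ : θ ≤ 1) (d : ℕ) : 0 ≤ degreePotential θ d :=
  Finset.prod_nonneg fun _ hj => one_sub_div_natCast_nonneg hθ (Finset.mem_Ico.1 hj).1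

theorem degreePotential_le_one (hθ₀ : 0 ≤ θ) (hθ₁ : θ ≤ 1) (d : ℕ) : degreePotential θ d ≤ 1 :=
  Finset.prod_le_one
    (fun _ hj => one_sub_div_natCast_nonneg hθ₁ (Finset.mem_Ico.1 hj).1)
    fun j _ => sub_le_self 1 (div_nonneg hθ₀ j.cast_nonneg)

theorem one_sub_le_sub_mul_degreePotential (hθ : θ ≤ 1) {d : ℕ} (hd : 1 ≤ d) :
    1 - θ ≤ (d - θ) * degreePotential θ d := by
  induction d, hd using Nat.le_induction with
  | base => simp [degreePotential]
  | succ d hd ih =>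
    have hd' : (1 : ℝ) ≤ d := by exact_mod_cast hd
    have hstep : (d : ℝ) - θ ≤ (d + 1 - θ) * (1 - θ / d) := by
      have : (d + 1 - θ) * (1 - θ / d) = (d - θ) + (1 - θ) * (d - θ) / d := by
        field_simp
        ring
      rw [this, le_add_iff_nonneg_right]
      exact div_nonneg (mul_nonneg (by linarith) (by linarith)) (by linarith)
    calc 1 - θ ≤ (d - θ) * degreePotential θ d := ih
      _ ≤ (d + 1 - θ) * (1 - θ / d) * degreePotential θ d := by
          gcongr
          exact degreePotential_nonneg hθ d
      _ = ((d + 1 : ℕ) - θ) * degreePotential θ (d + 1) := by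
          rw [degreePotential_succ hd]
          push_cast
          ring

theorem one_sub_le_mul_degreePotential (hθ₀ : 0 ≤ θ) (hθ₁ : θ ≤ 1) {d : ℕ} (hd : 1 ≤ d) :
    1 - θ ≤ d * degreePotential θ d :=
  (one_sub_le_sub_mul_degreePotential hθ₁ hd).trans <|
    mul_le_mul_of_nonneg_right (sub_le_self _ hθ₀) (degreePotential_nonneg hθ₁ d)

variable {V : Type} [DecidableEq V] [Fintype V] {u w : V} {G : Multigraph V}

theorem pmfMean_attachEdge_degreePotential (hθ : θ ≤ 1) (hw : w ≠ u) (hd : 1 ≤ G.degree w) :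
    (pmfMean (attachEdge u G) fun H => ENNReal.ofReal (degreePotential θ (H.degree w)))
      = ENNReal.ofReal ((1 - θ / (2 * G.card + 1)) * degreePotential θ (G.degree w)) := by
  rw [attachEdge, pmfMean_map]
  refine (pmfMean_ofReal _ fun v => degreePotential_nonneg hθ _).trans (congrArg _ ?_)
  set d := G.degree w
  set f := degreePotential θ d
  have hd' : (d : ℝ) ≠ 0 := Nat.cast_ne_zero.2 (by omega)
  have hgrowth (v : V) : degreePotential θ (degree (s(u, v) ::ₘ G) w)
      = f - if w = v then θ / d * f else 0 := by
    rw [degree_cons, if_neg hw, zero_add]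
    split_ifs
    · rw [degreePotential_succ hd]
      ring
    · rw [add_zero, sub_zero]
  calc ∑ v, (G.endpointLaw u v).toReal * degreePotential θ (degree (s(u, v) ::ₘ G) w)
      = f - (G.endpointLaw u w).toReal * (θ / d * f) := by
        simp only [hgrowth, mul_sub, Finset.sum_sub_distrib, ← Finset.sum_mul,
          sum_toReal_apply, one_mul, mul_ite, mul_zero, Finset.sum_ite_eq, Finset.mem_univ, if_true]
    _ = f - d / (2 * G.card + 1) * (θ / d * f) := by rw [toReal_endpointLaw_apply G hw]
    _ = (1 - θ / (2 * G.card + 1)) * f := by field_simp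

theorem pmfMean_attachEdges_degreePotential (hθ : θ ≤ 1) (hw : w ≠ u) (hd : 1 ≤ G.degree w)
    (k : ℕ) :
    (pmfMean (attachEdges u k G) fun H => ENNReal.ofReal (degreePotential θ (H.degree w)))
      = ENNReal.ofReal ((∏ j ∈ Finset.Ico G.card (G.card + k), (1 - θ / (2 * (j : ℝ) + 1)))
          * degreePotential θ (G.degree w)) := by
  induction k with
  | zero => simp [attachEdges, pmfMean_pure]
  | succ k ih =>
    have hstep : ∀ H ∈ (attachEdges u k G).support,
        (pmfMean (attachEdge u H) fun H' => ENNReal.ofReal (degreePotential θ (H'.degree w)))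
          = ENNReal.ofReal (1 - θ / (2 * (G.card + k : ℕ) + 1))
            * ENNReal.ofReal (degreePotential θ (H.degree w)) := fun H hH => by
      rw [pmfMean_attachEdge_degreePotential hθ hw
          (hd.trans (degree_le_of_mem_support_attachEdges hH w)),
        card_of_mem_support_attachEdges hH,
        ENNReal.ofReal_mul (one_sub_div_two_mul_add_one_nonneg hθ _)]
    rw [attachEdges, pmfMean_bind, pmfMean_congr hstep, pmfMean_const_mul, ih,
      ← ENNReal.ofReal_mul (one_sub_div_two_mul_add_one_nonneg hθ _), ← add_assoc,
      Finset.prod_Ico_succ_top (Nat.le_add_right _ _)]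
    congr 1
    ring

end DegreePotential

end Multigraph

section PreferentialAttachment

open Multigraph

open scoped Asymptotics

variable {m n : ℕ} {θ : ℝ}

-- At `n = 0` the new node is the only candidate endpoint, so this covers the initial graph too.
theorem paGraph_succ (m n : ℕ) :
    paGraph m (n + 1) = (paGraph m n).bind fun G =>
      attachEdges (Fin.last n) m (G.map (Sym2.map Fin.castSucc)) := by
  cases n with
  | zero => simp [paGraph, attachEdges_of_subsingleton, PMF.pure_bind]
  | succ n => rfl

theorem card_of_mem_support_paGraph {G : Multigraph (Fin n)} (h : G ∈ (paGraph m n).support) :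
    G.card = m * n := by
  induction n with
  | zero => simp [(PMF.mem_support_pure_iff _ _).1 h]
  | succ n ih =>
    rw [paGraph_succ, PMF.mem_support_bind_iff] at h
    obtain ⟨H, hH, h⟩ := h
    rw [card_of_mem_support_attachEdges h, Multiset.card_map, ih hH, mul_add_one]

theorem le_degree_of_mem_support_paGraph {G : Multigraph (Fin n)}
    (h : G ∈ (paGraph m n).support) (v : Fin n) : m ≤ G.degree v := by
  induction n with
  | zero => exact v.elim0
  | succ n ih =>
    rw [paGraph_succ, PMF.mem_support_bind_iff] at h
    obtain ⟨H, hH, h⟩ := h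
    induction v using Fin.lastCases with
    | last => exact le_degree_self_of_mem_support_attachEdges h
    | cast w =>
      calc m ≤ H.degree w := ih hH w
        _ = degree (H.map (Sym2.map Fin.castSucc)) w.castSucc :=
            (degree_map H (Fin.castSucc_injective n) w).symm
        _ ≤ G.degree w.castSucc := degree_le_of_mem_support_attachEdges h _

theorem pmfMean_paGraph_succ_degreePotential (hθ : θ ≤ 1) (hm : 1 ≤ m) (w : Fin n) :
    (pmfMean (paGraph m (n + 1)) fun G =>
        ENNReal.ofReal (degreePotential θ (G.degree w.castSucc)))
      = ENNReal.ofReal (∏ j ∈ Finset.Ico (m * n) (m * (n + 1)), (1 - θ / (2 * (j : ℝ) + 1)))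
        * pmfMean (paGraph m n) fun G => ENNReal.ofReal (degreePotential θ (G.degree w)) := by
  rw [paGraph_succ, pmfMean_bind, ← pmfMean_const_mul]
  refine pmfMean_congr fun G hG => ?_
  have hdeg := degree_map G (Fin.castSucc_injective n) w
  have hd : 1 ≤ degree (G.map (Sym2.map Fin.castSucc)) w.castSucc :=
    hdeg ▸ hm.trans (le_degree_of_mem_support_paGraph hG w)
  rw [pmfMean_attachEdges_degreePotential hθ w.castSucc_lt_last.ne hd, hdeg, Multiset.card_map,
    card_of_mem_support_paGraph hG, ← mul_add_one, ENNReal.ofReal_mul]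
  exact Finset.prod_nonneg fun j _ => one_sub_div_two_mul_add_one_nonneg hθ j

theorem pmfMean_paGraph_degreePotential_le_prod (hθ₀ : 0 ≤ θ) (hθ₁ : θ ≤ 1) (hm : 1 ≤ m)
    (v : Fin n) :
    (pmfMean (paGraph m n) fun G => ENNReal.ofReal (degreePotential θ (G.degree v)))
      ≤ ENNReal.ofReal
          (∏ j ∈ Finset.Ico (m * joinTime v) (m * n), (1 - θ / (2 * (j : ℝ) + 1))) := by
  induction n with
  | zero => exact v.elim0
  | succ n ih =>
    induction v using Fin.lastCases with
    | last =>
      calc _ ≤ pmfMean (paGraph m (n + 1)) fun _ => 1 := pmfMean_mono _ fun G =>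
            ENNReal.ofReal_le_one.2 (degreePotential_le_one hθ₀ hθ₁ _)
        _ = _ := by simp [pmfMean_const, joinTime]
    | cast w =>
      rw [pmfMean_paGraph_succ_degreePotential hθ₁ hm]
      refine (mul_le_mul_right (ih w) _).trans_eq ?_
      rw [← ENNReal.ofReal_mul
          (Finset.prod_nonneg fun j _ => one_sub_div_two_mul_add_one_nonneg hθ₁ j),
        mul_comm, Finset.prod_Ico_consecutive _
          (Nat.mul_le_mul_left m w.isLt : m * joinTime w ≤ m * n)
          (Nat.mul_le_mul_left m n.le_succ)]
      rfl

theorem pmfMean_paGraph_degreePotential_le (hθ₀ : 0 ≤ θ) (hθ₁ : θ ≤ 1) (hm : 1 ≤ m)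
    (v : Fin n) :
    (pmfMean (paGraph m n) fun G => ENNReal.ofReal (degreePotential θ (G.degree v)))
      ≤ ENNReal.ofReal ((2 * joinTime v / n) ^ (θ / 2)) :=
  (pmfMean_paGraph_degreePotential_le_prod hθ₀ hθ₁ hm v).trans <| ENNReal.ofReal_le_ofReal <|
    prod_Ico_one_sub_div_two_mul_add_one_le hθ₀ hθ₁ hm (Nat.le_add_left 1 v) v.isLt

theorem toOuterMeasure_paGraph_degree_lt_le (hθ₀ : 0 ≤ θ) (hθ₁ : θ < 1) (hm : 1 ≤ m) (v : Fin n)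
    (L : ℝ) :
    (paGraph m n).toOuterMeasure {G | (G.degree v : ℝ) < L}
      ≤ ENNReal.ofReal (L / (1 - θ) * (2 * joinTime v / n) ^ (θ / 2)) := by
  rw [ENNReal.ofReal_mul' (by positivity)]
  refine le_trans ?_ (mul_le_mul_right (pmfMean_paGraph_degreePotential_le hθ₀ hθ₁.le hm v) _)
  rw [← pmfMean_const_mul]
  refine toOuterMeasure_le_pmfMean fun G hG (hlt : (G.degree v : ℝ) < L) => ?_
  have hf := degreePotential_nonneg hθ₁.le (G.degree v)
  have hlow : 1 - θ ≤ L * degreePotential θ (G.degree v) :=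
    (one_sub_le_mul_degreePotential hθ₀ hθ₁.le
      (hm.trans (le_degree_of_mem_support_paGraph hG v))).trans (by gcongr)
  rw [← ENNReal.ofReal_mul' hf, ENNReal.one_le_ofReal, div_mul_eq_mul_div]
  exact (one_le_div (by linarith)).2 hlow

theorem card_filter_joinTime_lt_le {x : ℝ} (hx : 0 ≤ x) :
    ((Finset.univ.filter fun v : Fin n => (joinTime v : ℝ) < x).card : ℝ) ≤ x := by
  have hcard : (Finset.univ.filter fun v : Fin n => (joinTime v : ℝ) < x).card
      ≤ (Finset.range ⌊x⌋₊).card :=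
    Finset.card_le_card_of_injOn (fun v => (v : ℕ))
      (fun v hv => Finset.mem_coe.2 (Finset.mem_range.2
        (Nat.le_floor (Finset.mem_filter.1 hv).2.le : joinTime v ≤ ⌊x⌋₊)))
      Fin.val_injective.injOn
  rw [Finset.card_range] at hcard
  exact (Nat.cast_le.2 hcard).trans (Nat.floor_le hx)

theorem toOuterMeasure_paGraph_exists_degree_lt_le (hθ₀ : 0 ≤ θ) (hθ₁ : θ < 1) (hm : 1 ≤ m)
    (n : ℕ) {x L : ℝ} (hx : 0 ≤ x) (hL : 0 ≤ L) :
    (paGraph m n).toOuterMeasure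
        {G | ∃ v : Fin n, (joinTime v : ℝ) < x ∧ (G.degree v : ℝ) < L}
      ≤ ENNReal.ofReal (x * (L / (1 - θ) * (2 * x / n) ^ (θ / 2))) := by
  have : 0 < 1 - θ := sub_pos.2 hθ₁
  set early : Finset (Fin n) := Finset.univ.filter fun v => (joinTime v : ℝ) < x
  set ε : ℝ := L / (1 - θ) * (2 * x / n) ^ (θ / 2)
  have hunion : {G : Multigraph (Fin n) | ∃ v : Fin n, (joinTime v : ℝ) < x ∧ G.degree v < L}
      = ⋃ v ∈ early, {G | (G.degree v : ℝ) < L} := by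
    ext G
    simp [early]
  have hnode : ∀ v ∈ early, (paGraph m n).toOuterMeasure {G | (G.degree v : ℝ) < L}
      ≤ ENNReal.ofReal ε := fun v hv => by
    refine (toOuterMeasure_paGraph_degree_lt_le hθ₀ hθ₁ hm v L).trans
      (ENNReal.ofReal_le_ofReal ?_)
    have hvx : (joinTime v : ℝ) ≤ x := (Finset.mem_filter.1 hv).2.le
    simp only [ε]
    gcongr
  calc _ ≤ ∑ v ∈ early, (paGraph m n).toOuterMeasure {G | (G.degree v : ℝ) < L} :=
        hunion ▸ MeasureTheory.measure_biUnion_finset_le _ _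
    _ ≤ early.card • ENNReal.ofReal ε := Finset.sum_le_card_nsmul _ _ _ hnode
    _ = ENNReal.ofReal (early.card * ε) := by
        rw [nsmul_eq_mul, ENNReal.ofReal_mul (Nat.cast_nonneg _), ENNReal.ofReal_natCast]
    _ ≤ ENNReal.ofReal (x * ε) := by
        gcongr
        exact card_filter_joinTime_lt_le hx

theorem mainTheorem7_general (hm : 1 ≤ m) {α b : ℝ} (hαb : 3 * α + 2 * b < 1) {L : ℕ → ℝ}
    (hL : L =O[atTop] fun n : ℕ => (n : ℝ) ^ b) :
    Tendsto
      (fun n : ℕ => (paGraph m n).toOuterMeasure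
        {G : Multigraph (Fin n) | ∀ v : Fin n, (joinTime v : ℝ) < (n : ℝ) ^ α →
          L n ≤ (G.degree v : ℝ)})
      atTop (𝓝 1) := by
  obtain ⟨θ, hθ₀, hθ₁, hexp⟩ := exists_union_bound_exponent_neg hαb
  obtain ⟨C, hC, hLC⟩ := hL.exists_nonneg
  have hbound := ENNReal.tendsto_ofReal (tendsto_union_bound hexp C)
  rw [ENNReal.ofReal_zero] at hbound
  refine tendsto_toOuterMeasure_one_of_compl <|
    tendsto_of_tendsto_of_tendsto_of_le_of_le' tendsto_const_nhds hbound
    (Eventually.of_forall fun _ => zero_le) ?_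
  filter_upwards [hLC.bound] with n hn
  have hLn : L n ≤ C * (n : ℝ) ^ b := by
    simpa only [Real.norm_of_nonneg (Real.rpow_nonneg n.cast_nonneg b)] using
      (Real.le_norm_self _).trans hn
  refine le_trans (MeasureTheory.measure_mono fun G hG => ?_)
    (toOuterMeasure_paGraph_exists_degree_lt_le hθ₀ hθ₁ hm n (by positivity) (by positivity))
  simp only [Set.mem_compl_iff, Set.mem_ofPred_eq, not_forall, not_le] at hG
  obtain ⟨v, hv, hlt⟩ := hG
  exact ⟨v, hv, hlt.trans_le hLn⟩

end PreferentialAttachment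

theorem mainTheorem7 (m : ℕ) (hm : 1 ≤ m) :
    Tendsto
      (fun n : ℕ => (paGraph m n).toOuterMeasure
        {G : Multigraph (Fin n) | ∀ v : Fin n, (joinTime v : ℝ) < (n : ℝ) ^ (0.3 : ℝ) →
          Real.log (n : ℝ) ^ 3 ≤ (G.degree v : ℝ)})
      atTop (𝓝 1) :=
  mainTheorem7_general hm (b := 0.01) (by norm_num) (isBigO_log_natCast_pow_rpow 3 (by norm_num))
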